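/- Let $n\ge 0$ be an integer, let $\lambda$ be a Young diagram with $n$ cells, and let $d_\lambda$ be the dimension of the corresponding irreducible complex representation of the symmetric group $S_n$ (the Specht module of $\lambda$, i.e. the left ideal $\mathbb{C}[S_n]c_T$ generated by the Young symmetrizer $c_T$ of a tableau $T$ of shape $\lambda$). Call this representation *big* if $$d_\lambda > e^{-\sqrt{n}\,\log n}\,\sqrt{n!}\,,$$ where $\log$ is the natural logarithm and $\sqrt{n}\,\log n$ is read as $0$ for $n=0$. If it is big, then the width of $\lambda$ (the length of its first row) and the height of $\lambda$ (the length of its first column) are both less than $4\sqrt{n}\,\log n$. -/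

import Mathlib

noncomputable section

/-- A Young tableau of shape `μ` with entries `0, …, n - 1`, given by the cell in which each entry
stands. Such a tableau exists exactly when `μ` has `n` cells. -/
abbrev YoungTableau (n : ℕ) (μ : YoungDiagram) : Type :=
  Fin n ≃ {c : ℕ × ℕ // c ∈ μ.cells}

namespace YoungTableau

variable {n : ℕ} {μ : YoungDiagram}

/-- The permutations that keep every entry of the tableau in its row
(the row of a cell is its first coordinate). -/
def rowGroup (T : YoungTableau n μ) : Subgroup (Equiv.Perm (Fin n)) where
  carrier := {σ | ∀ i, (T (σ i)).1.1 = (T i).1.1}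
  one_mem' := fun _ => rfl
  mul_mem' := fun {a b} ha hb i => (ha (b i)).trans (hb i)
  inv_mem' := fun {a} ha i => by
    have h := ha (a⁻¹ i)
    rw [← Equiv.Perm.mul_apply, mul_inv_cancel, Equiv.Perm.one_apply] at h
    exact h.symm

/-- The permutations that keep every entry of the tableau in its column
(the column of a cell is its second coordinate). -/
def colGroup (T : YoungTableau n μ) : Subgroup (Equiv.Perm (Fin n)) where
  carrier := {σ | ∀ i, (T (σ i)).1.2 = (T i).1.2}
  one_mem' := fun _ => rfl
  mul_mem' := fun {a b} ha hb i => (ha (b i)).trans (hb i)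
  inv_mem' := fun {a} ha i => by
    have h := ha (a⁻¹ i)
    rw [← Equiv.Perm.mul_apply, mul_inv_cancel, Equiv.Perm.one_apply] at h
    exact h.symm

open Classical in
/-- The Young symmetrizer `(∑ p) (∑ sgn(q) q)` of a tableau, where `p` runs through the row group
and `q` through the column group. -/
def symmetrizer (T : YoungTableau n μ) : MonoidAlgebra ℂ (Equiv.Perm (Fin n)) :=
  (∑ p : T.rowGroup, MonoidAlgebra.of ℂ (Equiv.Perm (Fin n)) p) *
    ∑ q : T.colGroup, ((Equiv.Perm.sign (q : Equiv.Perm (Fin n)) : ℤ) : ℂ) •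
      MonoidAlgebra.of ℂ (Equiv.Perm (Fin n)) q

/-- The Specht module of a tableau: the left ideal of the group algebra `ℂ[S_n]` generated by the
Young symmetrizer. Up to isomorphism it depends only on the shape. -/
abbrev spechtModule (T : YoungTableau n μ) : Ideal (MonoidAlgebra ℂ (Equiv.Perm (Fin n))) :=
  Ideal.span {T.symmetrizer}

end YoungTableau

/-- `ρ` is (a copy of) the irreducible representation of `S_n` that corresponds to the Young
diagram `μ`: it is isomorphic to the Specht module of a tableau of shape `μ` (so `μ` has `n`
cells). -/
def IsIrrepOfShape {n : ℕ} {V : Type*} [AddCommGroup V] [Module ℂ V]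
    (ρ : Representation ℂ (Equiv.Perm (Fin n)) V) (μ : YoungDiagram) : Prop :=
  ∃ T : YoungTableau n μ,
    Nonempty (ρ.asModule ≃ₗ[MonoidAlgebra ℂ (Equiv.Perm (Fin n))] T.spechtModule)

/-- A representation of `S_n` is big if its dimension exceeds `e^{-√n log n} √(n!)`. -/
def IsBig {n : ℕ} {V : Type*} [AddCommGroup V] [Module ℂ V]
    (_ρ : Representation ℂ (Equiv.Perm (Fin n)) V) : Prop :=
  Real.exp (-(√(n : ℝ) * Real.log n)) * √(n.factorial : ℝ) < (Module.finrank ℂ V : ℝ)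

end

/-!
Let `r` be the number of entries in the first row (or column) of a tableau. The Specht module
contains a nonzero vector on which the permutations of these entries act trivially (or by the sign).
The space of all vectors with this property is a representation of the group `S_{n-r}` permuting
the other entries, and an irreducible subrepresentation `U` of it has dimension at most
`√((n-r)!)`. Since `U` is stable under `S_r × S_{n-r}`, the translates of `U` by `C(n, r)` coset
representatives span the irreducible representation, so that
`d ≤ C(n, r) √((n-r)!) ≤ √(n!) · √n ^ r / r!`, which is too small for a big representation as soon
as `r ≥ 4 √n log n`.

Irreducibility of the Specht module follows from von Neumann's lemma: the Young symmetrizer `c`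
satisfies `c x c ∈ ℂ c` for all `x`. This rests on a dichotomy for permutations `g`: either two
entries share both a row of the tableau `T` and a column of `g • T`, and `g` contributes zero, or
the cells (row in `T`, column in `g • T`) are distinct. In the latter case they fill the diagram,
because the diagram is the unique set of cells that maximizes the sum of hook lengths, and this
sum is the same for both sets. Hence `g` is a product of a row and a column permutation.
-/

open scoped MonoidAlgebra

section DimensionBounds

theorem finrank_sq_le_finrank_of_isSimpleModule (k A M : Type*) [Field k] [IsAlgClosed k] [Ring A]
    [Algebra k A] [FiniteDimensional k A] [AddCommGroup M] [Module k M] [Module A M]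
    [IsScalarTower k A M] [IsSimpleModule A M] :
    Module.finrank k M ^ 2 ≤ Module.finrank k A := by
  have : FiniteDimensional k M := Module.Finite.trans A M
  have hsurj : Function.Surjective (Algebra.lsmul k k M : A →ₐ[k] Module.End k M).toLinearMap := by
    intro f
    -- By Schur's lemma `f` commutes with `End A M`, so the density theorem applies to it.
    let f' : Module.End (Module.End A M) M :=
      { f with
        map_smul' := fun φ v => by
          obtain ⟨c, rfl⟩ :=
            (IsSimpleModule.algebraMap_end_bijective_of_isAlgClosed (A := A) (V := M) k).2 φ
          exact f.map_smul c v }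
    obtain ⟨s, hs⟩ := Module.Finite.fg_top (R := k) (M := M)
    obtain ⟨a, ha⟩ := jacobson_density f' s
    exact ⟨a, LinearMap.ext_on hs fun v hv => (ha v hv).symm⟩
  simpa only [Module.finrank_linearMap, ← sq] using LinearMap.finrank_le_finrank_of_surjective hsurj

theorem finrank_finsetSup_le_sum {k V ι : Type*} [DivisionRing k] [AddCommGroup V]
    [Module k V] (s : Finset ι) (W : ι → Submodule k V) [∀ i, FiniteDimensional k (W i)] :
    Module.finrank k (s.sup W : Submodule k V) ≤ ∑ i ∈ s, Module.finrank k (W i) := by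
  induction s using Finset.cons_induction with
  | empty => simp
  | cons i s hi ih =>
    rw [Finset.sup_cons, Finset.sum_cons]
    exact (Submodule.finrank_add_le_finrank_add_finrank _ _).trans (by gcongr)

variable {k G V : Type*} [Field k] [Group G] [AddCommGroup V] [Module k V]

theorem iSup_map_eq_top_of_isIrreducible (ρ : Representation k G V) [ρ.IsIrreducible]
    {U : Submodule k V} (hU : U ≠ ⊥) : ⨆ g, U.map (ρ g) = ⊤ := by
  let W : Subrepresentation ρ :=
    { toSubmodule := ⨆ g, U.map (ρ g)
      apply_mem_toSubmodule := fun h v hv => by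
        have hle : (⨆ g, U.map (ρ g)).map (ρ h) ≤ ⨆ g, U.map (ρ g) := by
          rw [Submodule.map_iSup]
          refine iSup_le fun g => ?_
          rw [← Submodule.map_comp, ← Module.End.mul_eq_comp, ← map_mul]
          exact le_iSup (fun g => U.map (ρ g)) (h * g)
        exact hle (Submodule.mem_map_of_mem hv) }
  have hUW : U ≤ W.toSubmodule := by
    simpa [Module.End.one_eq_id] using le_iSup (fun g => U.map (ρ g)) 1
  refine congrArg Subrepresentation.toSubmodule ((eq_bot_or_eq_top W).resolve_left fun hW => hU ?_)
  exact eq_bot_iff.2 (hUW.trans (congrArg Subrepresentation.toSubmodule hW).le)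

theorem finrank_le_index_mul_finrank (ρ : Representation k G V) [ρ.IsIrreducible] (K : Subgroup G)
    [K.FiniteIndex] {U : Submodule k V} [FiniteDimensional k U] (hU : U ≠ ⊥)
    (hK : ∀ h ∈ K, U ≤ U.comap (ρ h)) :
    Module.finrank k V ≤ K.index * Module.finrank k U := by
  have : Fintype (G ⧸ K) := Fintype.ofFinite _
  have hle (g : G) : U.map (ρ g) ≤ U.map (ρ (g : G ⧸ K).out) := by
    obtain ⟨⟨h, hh⟩, hout⟩ := QuotientGroup.mk_out_eq_mul K g
    have hg : g = (g : G ⧸ K).out * h⁻¹ := by rw [hout, mul_inv_cancel_right]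
    conv_lhs => rw [hg, map_mul, Module.End.mul_eq_comp, Submodule.map_comp]
    exact Submodule.map_mono (Submodule.map_le_iff_le_comap.2 (hK _ (K.inv_mem hh)))
  have htop : Finset.univ.sup (fun q : G ⧸ K => U.map (ρ q.out)) = ⊤ := by
    rw [Finset.sup_univ_eq_iSup, eq_top_iff, ← iSup_map_eq_top_of_isIrreducible ρ hU]
    exact iSup_le fun g => (hle g).trans (le_iSup (fun q : G ⧸ K => U.map (ρ q.out)) g)
  calc Module.finrank k V
      ≤ ∑ q : G ⧸ K, Module.finrank k (U.map (ρ q.out)) := by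
        rw [← finrank_top k V, ← htop]
        exact finrank_finsetSup_le_sum _ _
    _ ≤ ∑ _q : G ⧸ K, Module.finrank k U := by
        gcongr
        exact Submodule.finrank_map_le _ _
    _ = K.index * Module.finrank k U := by
        rw [Finset.sum_const, smul_eq_mul, Finset.card_univ, ← Nat.card_eq_fintype_card,
          Subgroup.index]

theorem exists_le_finrank_sq_le_card [IsAlgClosed k] [Finite G] [FiniteDimensional k V]
    {ρ : Representation k G V} {X : Subrepresentation ρ} (hX : X ≠ ⊥) :
    ∃ U ≤ X, U ≠ ⊥ ∧ Module.finrank k U.toSubmodule ^ 2 ≤ Nat.card G := by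
  have : FiniteDimensional k ρ.asModule := inferInstanceAs (FiniteDimensional k V)
  have : IsArtinian k[G] ρ.asModule := isArtinian_of_tower k inferInstance
  let φ := Subrepresentation.subrepresentationSubmoduleOrderIso (ρ := ρ)
  obtain ⟨S, hS, hSX⟩ := (eq_bot_or_exists_atom_le (φ X)).resolve_left ((map_eq_bot_iff φ).not.2 hX)
  have : IsSimpleModule k[G] S := isSimpleModule_iff_isAtom.2 hS
  refine ⟨φ.symm S, φ.symm_apply_le.2 hSX, (map_eq_bot_iff φ.symm).not.2 hS.1, ?_⟩
  have hdim : Module.finrank k k[G] = Nat.card G := by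
    rw [(MonoidAlgebra.coeffLinearEquiv k).finrank_eq, Module.finrank_eq_nat_card_basis
      Finsupp.basisSingleOne]
  have : FiniteDimensional k k[G] := Module.Finite.equiv (MonoidAlgebra.coeffLinearEquiv k).symm
  exact hdim ▸ finrank_sq_le_finrank_of_isSimpleModule k k[G] S

/-- The subspace on which the first factor acts through the function `χ`, as a representation of the
second factor, for a representation of `G` pulled back along a homomorphism `f : A × B →* G`. -/
def eigenSubrepresentation {A B : Type*} [Group A] [Group B] (ρ : Representation k G V)
    (f : A × B →* G) (χ : A → k) :
    Subrepresentation (ρ.comp (f.comp (MonoidHom.inr A B)) : Representation k B V) where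
  toSubmodule := ⨅ a, Module.End.eigenspace (ρ (f (a, 1))) (χ a)
  apply_mem_toSubmodule b v hv := by
    refine (Submodule.mem_iInf _).2 fun a => ?_
    have hcomm : Commute (ρ (f (a, 1))) (ρ (f (1, b))) :=
      ((MonoidHom.commute_inl_inr a b).map f).map ρ
    exact Module.End.mapsTo_genEigenspace_of_comm hcomm _ _ ((Submodule.mem_iInf _).1 hv a)

theorem mem_eigenSubrepresentation {A B : Type*} [Group A] [Group B] {ρ : Representation k G V}
    {f : A × B →* G} {χ : A → k} {v : V} :
    v ∈ eigenSubrepresentation ρ f χ ↔ ∀ a, ρ (f (a, 1)) v = χ a • v := by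
  change v ∈ ⨅ a, Module.End.eigenspace (ρ (f (a, 1))) (χ a) ↔ _
  simp only [Submodule.mem_iInf, Module.End.mem_eigenspace_iff]

theorem finrank_le_index_mul_sqrt_card [IsAlgClosed k] [FiniteDimensional k V] {A B : Type*}
    [Group A] [Group B] [Finite B] (ρ : Representation k G V) [ρ.IsIrreducible] (f : A × B →* G)
    [f.range.FiniteIndex] (χ : A → k) {v : V} (hv0 : v ≠ 0)
    (hv : ∀ a, ρ (f (a, 1)) v = χ a • v) :
    (Module.finrank k V : ℝ) ≤ f.range.index * √(Nat.card B : ℝ) := by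
  have hX : eigenSubrepresentation ρ f χ ≠ ⊥ := fun h => hv0 <| by
    have hmem : v ∈ eigenSubrepresentation ρ f χ := mem_eigenSubrepresentation.2 hv
    rw [h] at hmem
    exact (Submodule.mem_bot k).1 hmem
  obtain ⟨U, hUX, hU0, hUdim⟩ := exists_le_finrank_sq_le_card hX
  have hstable : ∀ h ∈ f.range, U.toSubmodule ≤ U.toSubmodule.comap (ρ h) := by
    rintro _ ⟨⟨a, b⟩, rfl⟩ u hu
    have hsplit : f (a, b) = f (1, b) * f (a, 1) := by simp [← map_mul]
    rw [Submodule.mem_comap, hsplit, map_mul, Module.End.mul_apply,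
      mem_eigenSubrepresentation.1 (hUX hu) a]
    exact U.apply_mem_toSubmodule b (U.toSubmodule.smul_mem _ hu)
  have hindex := finrank_le_index_mul_finrank ρ f.range
    (fun h => hU0 (Subrepresentation.toSubmodule_injective h)) hstable
  calc (Module.finrank k V : ℝ) ≤ f.range.index * Module.finrank k U.toSubmodule := by
        exact_mod_cast hindex
    _ ≤ f.range.index * √(Nat.card B : ℝ) := by
        gcongr
        exact Real.le_sqrt_of_sq_le (by exact_mod_cast hUdim)

theorem finrank_mul_factorial_mul_sqrt_factorial_le [IsAlgClosed k] [FiniteDimensional k V]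
    {α : Type*} [Fintype α] (ρ : Representation k (Equiv.Perm α) V) [ρ.IsIrreducible]
    (s : Finset α) (χ : Equiv.Perm α → k) {v : V} (hv0 : v ≠ 0)
    (hv : ∀ σ : Equiv.Perm α, (∀ x ∉ s, σ x = x) → ρ σ v = χ σ • v) :
    (Module.finrank k V : ℝ) * s.card.factorial * √((Fintype.card α - s.card).factorial : ℝ) ≤
      (Fintype.card α).factorial := by
  classical
  let f := Equiv.Perm.subtypeCongrHom (· ∈ s)
  have hcard : f.range.index * (s.card.factorial * (Fintype.card α - s.card).factorial) =
      (Fintype.card α).factorial := by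
    have h := f.range.card_mul_index
    rw [Nat.card_congr (f.ofInjective (Equiv.Perm.subtypeCongrHom_injective _)).symm.toEquiv,
      Nat.card_prod, Nat.card_perm, Nat.card_perm, Nat.card_perm] at h
    simpa [Fintype.card_subtype_compl, mul_comm] using h
  have hdim := finrank_le_index_mul_sqrt_card ρ f (fun a => χ (f (a, 1))) hv0 fun a =>
    hv _ fun x hx => by simp [f, Equiv.Perm.subtypeCongr.right_apply, hx]
  have hB : Nat.card (Equiv.Perm {x // x ∉ s}) = (Fintype.card α - s.card).factorial := by
    rw [Nat.card_perm, Nat.card_eq_fintype_card, Fintype.card_subtype_compl, Fintype.card_coe]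
  rw [hB] at hdim
  calc (Module.finrank k V : ℝ) * s.card.factorial * √((Fintype.card α - s.card).factorial : ℝ)
      ≤ f.range.index * √((Fintype.card α - s.card).factorial : ℝ) * s.card.factorial *
          √((Fintype.card α - s.card).factorial : ℝ) := by gcongr
    _ = f.range.index * (s.card.factorial *
          √((Fintype.card α - s.card).factorial : ℝ) ^ 2) := by ring
    _ = (Fintype.card α).factorial := by
        rw [Real.sq_sqrt (by positivity)]
        exact_mod_cast hcard

end DimensionBounds

section Estimates

theorem pow_div_factorial_le_exp_neg {x : ℝ} (hx : 0 ≤ x) {r : ℕ} (h : 4 * x ≤ r) :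
    x ^ r / r.factorial ≤ Real.exp (-(r / 4)) := by
  have hquarter : (1 / 4 : ℝ) ≤ Real.exp (-(5 / 4)) := by
    have hlog : Real.log (1 / 4) = -(2 * Real.log 2) := by
      rw [one_div, Real.log_inv, show (4 : ℝ) = 2 ^ 2 by norm_num, Real.log_pow, Nat.cast_ofNat]
    rw [← Real.log_le_iff_le_exp (by norm_num), hlog]
    linarith [Real.log_two_gt_d9]
  calc x ^ r / r.factorial = (1 / 4) ^ r * ((4 * x) ^ r / r.factorial) := by
        rw [← mul_div_assoc, ← mul_pow]; ring
    _ ≤ Real.exp (-(5 / 4)) ^ r * Real.exp r := by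
        gcongr
        exact (Real.pow_div_factorial_le_exp _ (by positivity) r).trans (Real.exp_le_exp.2 h)
    _ = Real.exp (-(r / 4)) := by rw [← Real.exp_nat_mul, ← Real.exp_add]; ring_nf

theorem sqrt_pow_div_factorial_le_exp_neg {n r : ℕ} (hr : r ≤ n)
    (h : 4 * √(n : ℝ) * Real.log n ≤ r) :
    √(n : ℝ) ^ r / r.factorial ≤ Real.exp (-(√(n : ℝ) * Real.log n)) := by
  obtain hn | rfl | hn : n ≤ 1 ∨ n = 2 ∨ 3 ≤ n := by omega
  · obtain ⟨rfl, rfl⟩ | ⟨rfl, rfl⟩ | ⟨rfl, rfl⟩ :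
      n = 0 ∧ r = 0 ∨ n = 1 ∧ r = 0 ∨ n = 1 ∧ r = 1 := by omega
    all_goals simp
  · have hr2 : (r : ℝ) ≤ 2 := by exact_mod_cast hr
    have hsqrt : (1 : ℝ) ≤ √2 := Real.one_le_sqrt.2 (by norm_num)
    push_cast at h
    nlinarith [Real.log_two_gt_d9]
  · have hlog : 1 ≤ Real.log n := by
      rw [Real.le_log_iff_exp_le (by positivity)]
      exact Real.exp_one_lt_three.le.trans (by exact_mod_cast hn)
    have hsqrt : 4 * √(n : ℝ) ≤ r := (le_mul_of_one_le_right (by positivity) hlog).trans h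
    refine (pow_div_factorial_le_exp_neg (Real.sqrt_nonneg _) hsqrt).trans (Real.exp_le_exp.2 ?_)
    linarith

theorem sqrt_factorial_le_sqrt_factorial_sub_mul {n r : ℕ} (hr : r ≤ n) :
    √(n.factorial : ℝ) ≤ √((n - r).factorial : ℝ) * √(n : ℝ) ^ r := by
  have h : n.factorial ≤ (n - r).factorial * n ^ r := by
    rw [← Nat.factorial_mul_descFactorial hr]
    gcongr
    exact n.descFactorial_le_pow r
  refine Real.sqrt_le_iff.2 ⟨by positivity, ?_⟩
  rw [mul_pow, pow_right_comm, Real.sq_sqrt (by positivity), Real.sq_sqrt (by positivity)]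
  exact_mod_cast h

theorem card_lt_of_isBig {n : ℕ} {V : Type*} [AddCommGroup V] [Module ℂ V] [FiniteDimensional ℂ V]
    {ρ : Representation ℂ (Equiv.Perm (Fin n)) V} [ρ.IsIrreducible] (hbig : IsBig ρ)
    (s : Finset (Fin n)) (χ : Equiv.Perm (Fin n) → ℂ) {v : V} (hv0 : v ≠ 0)
    (hv : ∀ σ : Equiv.Perm (Fin n), (∀ x ∉ s, σ x = x) → ρ σ v = χ σ • v) :
    (s.card : ℝ) < 4 * √(n : ℝ) * Real.log n := by
  set r := s.card
  have hr : r ≤ n := by simpa using s.card_le_univ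
  have hdim := finrank_mul_factorial_mul_sqrt_factorial_le ρ s χ hv0 hv
  rw [Fintype.card_fin] at hdim
  have hupper : (Module.finrank ℂ V : ℝ) ≤ √(n.factorial : ℝ) * (√(n : ℝ) ^ r / r.factorial) := by
    rw [← mul_div_assoc, le_div_iff₀ (by positivity)]
    refine le_of_mul_le_mul_right ?_ (Real.sqrt_pos.2 (by positivity : (0 : ℝ) < (n - r).factorial))
    calc _ ≤ (n.factorial : ℝ) := hdim
      _ = √(n.factorial : ℝ) * √(n.factorial : ℝ) := (Real.mul_self_sqrt (by positivity)).symm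
      _ ≤ √(n.factorial : ℝ) * (√((n - r).factorial : ℝ) * √(n : ℝ) ^ r) := by
          gcongr
          exact sqrt_factorial_le_sqrt_factorial_sub_mul hr
      _ = _ := by ring
  by_contra! hle
  refine hbig.not_ge (hupper.trans ?_)
  rw [mul_comm]
  gcongr
  exact sqrt_pow_div_factorial_le_exp_neg hr hle

end Estimates
section GroupAlgebra

theorem isSimpleModule_span_singleton {k A : Type*} [Field k] [Ring A] [Algebra k A]
    [IsSemisimpleRing A] {c : A} (hc : c ≠ 0) (h : ∀ x, ∃ r : k, c * x * c = r • c) :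
    IsSimpleModule A (Ideal.span {c}) := by
  refine isSimpleModule_iff_isAtom.2 ⟨by simpa using hc, fun U hU => ?_⟩
  by_contra hU0
  obtain ⟨e, he, rfl⟩ := IsSemisimpleRing.ideal_eq_span_idempotent U
  obtain ⟨y, rfl⟩ := Ideal.mem_span_singleton'.1 (hU.le (Ideal.mem_span_singleton_self e))
  obtain ⟨r, hr⟩ := h y
  have hsmul : r • (y * c) = y * c := by
    rw [← mul_smul_comm, ← hr, mul_assoc c, ← mul_assoc y, he.eq]
  have hr0 : r ≠ 0 := by
    rintro rfl
    exact hU0 (by rw [← hsmul, zero_smul, Ideal.span_singleton_zero])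
  refine hU.not_ge ((Ideal.span_singleton_le_iff_mem _).2 ?_)
  have hmem : r • c ∈ Ideal.span {y * c} := by
    rw [← hr, mul_assoc]
    exact Ideal.mul_mem_left _ c (Ideal.mem_span_singleton_self _)
  simpa only [inv_smul_smul₀ hr0] using Submodule.smul_of_tower_mem (Ideal.span {y * c}) r⁻¹ hmem

variable {k G : Type*} [Group G]

/-- The sum `∑ χ(h) h` over a subgroup, in the group algebra. Up to a scalar it is the projection to
the vectors on which the subgroup acts through the inverse of the character `χ`. -/
noncomputable def twistedSum [CommSemiring k] (χ : G →* k) (H : Subgroup G) [Fintype H] : k[G] :=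
  ∑ h : H, χ h • MonoidAlgebra.of k G h

section CommSemiring

variable [CommSemiring k] {χ : G →* k} {H : Subgroup G} [Fintype H] {h : G}

theorem of_mul_twistedSum (hh : h ∈ H) :
    MonoidAlgebra.of k G h * twistedSum χ H = χ h⁻¹ • twistedSum χ H := by
  rw [twistedSum, Finset.mul_sum, Finset.smul_sum]
  refine Fintype.sum_equiv (Equiv.mulLeft ⟨h, hh⟩) _ _ fun x => ?_
  rw [mul_smul_comm, ← map_mul, smul_smul, ← map_mul]
  simp

theorem twistedSum_mul_of (hh : h ∈ H) :
    twistedSum χ H * MonoidAlgebra.of k G h = χ h⁻¹ • twistedSum χ H := by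
  rw [twistedSum, Finset.sum_mul, Finset.smul_sum]
  refine Fintype.sum_equiv (Equiv.mulRight ⟨h, hh⟩) _ _ fun x => ?_
  rw [smul_mul_assoc, ← map_mul, smul_smul, mul_comm, ← map_mul]
  simp

theorem twistedSum_mul_twistedSum_ne_zero [Nontrivial k] {ψ : G →* k} {R C : Subgroup G}
    [Fintype R] [Fintype C] (h : Disjoint R C) :
    twistedSum χ R * twistedSum ψ C ≠ 0 := by
  classical
  have hterm (p : R) (q : C) :
      ((χ p • MonoidAlgebra.of k G p) * (ψ q • MonoidAlgebra.of k G q)).coeff 1 =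
        if p = 1 ∧ q = 1 then 1 else 0 := by
    rw [smul_mul_smul_comm, ← map_mul, MonoidAlgebra.of_apply, MonoidAlgebra.coeff_smul,
      MonoidAlgebra.coeff_single, Finsupp.smul_apply, Finsupp.single_apply]
    have hpq : (p : G) * q = 1 ↔ p = 1 ∧ q = 1 := by
      simpa using Subgroup.mul_injective_of_disjoint h |>.eq_iff (a := (p, q)) (b := 1)
    by_cases h1 : p = 1 ∧ q = 1 <;> simp [hpq, h1]
  have hcoeff : (twistedSum χ R * twistedSum ψ C).coeff 1 = 1 := by
    rw [twistedSum, twistedSum, Finset.sum_mul_sum]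
    simp only [MonoidAlgebra.coeff_sum, Finsupp.finsetSum_apply, hterm]
    simp [ite_and]
  intro hzero
  simp [hzero] at hcoeff

end CommSemiring

variable [Field k] {χ ψ : G →* k} {R C : Subgroup G} [Fintype R] [Fintype C]

theorem twistedSum_mul_of_mul_twistedSum_eq_zero {g p q : G} (hp : p ∈ R) (hq : q ∈ C)
    (hpq : p * g = g * q) (hne : χ p ≠ ψ q) :
    twistedSum χ R * MonoidAlgebra.of k G g * twistedSum ψ C = 0 := by
  have h : χ p⁻¹ • (twistedSum χ R * MonoidAlgebra.of k G g * twistedSum ψ C) =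
      ψ q⁻¹ • (twistedSum χ R * MonoidAlgebra.of k G g * twistedSum ψ C) := by
    rw [← smul_mul_assoc, ← smul_mul_assoc, ← twistedSum_mul_of hp, mul_assoc (twistedSum χ R),
      ← map_mul, hpq, map_mul, ← mul_assoc, mul_assoc, of_mul_twistedSum hq, mul_smul_comm]
  rw [← sub_eq_zero, ← sub_smul, smul_eq_zero, sub_eq_zero] at h
  refine h.resolve_left fun heq => hne ?_
  have hχ : χ p * χ p⁻¹ = 1 := by rw [← map_mul, mul_inv_cancel, map_one]
  have hψ : ψ q * ψ q⁻¹ = 1 := by rw [← map_mul, mul_inv_cancel, map_one]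
  rw [eq_inv_of_mul_eq_one_left hχ, heq, ← eq_inv_of_mul_eq_one_left hψ]

theorem twistedSum_mul_mul_twistedSum_mem_span
    (h : ∀ g, (∃ p ∈ R, ∃ q ∈ C, g = p * q) ∨ ∃ p ∈ R, ∃ q ∈ C, p * g = g * q ∧ χ p ≠ ψ q)
    (x : k[G]) :
    twistedSum χ R * x * twistedSum ψ C ∈ Submodule.span k {twistedSum χ R * twistedSum ψ C} := by
  induction x using MonoidAlgebra.induction_linear with
  | zero => simp
  | add x y hx hy => rw [mul_add, add_mul]; exact add_mem hx hy
  | single g c =>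
    have hsingle : MonoidAlgebra.single g c = c • MonoidAlgebra.of k G g := by simp
    rw [hsingle, mul_smul_comm, smul_mul_assoc]
    refine Submodule.smul_mem _ c ?_
    obtain ⟨p, hp, q, hq, rfl⟩ | ⟨p, hp, q, hq, hpq, hne⟩ := h g
    · rw [map_mul, ← mul_assoc, twistedSum_mul_of hp, mul_assoc, of_mul_twistedSum hq,
        smul_mul_smul_comm]
      exact Submodule.smul_mem _ _ (Submodule.mem_span_singleton_self _)
    · rw [twistedSum_mul_of_mul_twistedSum_eq_zero hp hq hpq hne]
      exact zero_mem _

end GroupAlgebra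

section HookLengths

/-- The hook length of a cell. The same formula is used outside the diagram, where it is negative;
as the sum of a function of the row and a function of the column, its total over a set of cells
depends only on how many cells each row and each column contains. -/
def hookLength (μ : YoungDiagram) (c : ℕ × ℕ) : ℤ :=
  (μ.rowLen c.1 - c.1) + (μ.colLen c.2 - c.2 - 1)

theorem hookLength_pos_of_mem {μ : YoungDiagram} {c : ℕ × ℕ} (hc : c ∈ μ.cells) :
    0 < hookLength μ c := by
  have hrow := YoungDiagram.mem_iff_lt_rowLen.1 ((YoungDiagram.mem_cells c).1 hc)
  have hcol := YoungDiagram.mem_iff_lt_colLen.1 ((YoungDiagram.mem_cells c).1 hc)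
  rw [hookLength]
  omega

theorem hookLength_neg_of_notMem {μ : YoungDiagram} {c : ℕ × ℕ} (hc : c ∉ μ.cells) :
    hookLength μ c < 0 := by
  have hrow := mt YoungDiagram.mem_iff_lt_rowLen.2 (mt (YoungDiagram.mem_cells c).2 hc)
  have hcol := mt YoungDiagram.mem_iff_lt_colLen.2 (mt (YoungDiagram.mem_cells c).2 hc)
  rw [hookLength]
  omega

theorem subset_cells_of_sum_hookLength_le {μ : YoungDiagram} {A : Finset (ℕ × ℕ)}
    (h : ∑ c ∈ μ.cells, hookLength μ c ≤ ∑ c ∈ A, hookLength μ c) : A ⊆ μ.cells := by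
  rw [← Finset.sdiff_eq_empty_iff_subset]
  by_contra hne
  have hneg : ∑ c ∈ A \ μ.cells, hookLength μ c < 0 :=
    Finset.sum_neg (fun c hc => hookLength_neg_of_notMem (Finset.mem_sdiff.1 hc).2)
      (Finset.nonempty_iff_ne_empty.2 hne)
  have hnonneg : 0 ≤ ∑ c ∈ μ.cells \ A, hookLength μ c :=
    Finset.sum_nonneg fun c hc => (hookLength_pos_of_mem (Finset.mem_sdiff.1 hc).1).le
  have := Finset.sum_sdiff_sub_sum_sdiff (s₁ := A) (s₂ := μ.cells) (f := hookLength μ)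
  omega

end HookLengths

theorem apply_perm_eq_of_forall_ne {α β : Type*} {F : α → β} {b : β} {σ : Equiv.Perm α}
    (h : ∀ x, F x ≠ b → σ x = x) (x : α) : F (σ x) = F x := by
  by_cases hx : F x = b
  · by_cases hσx : F (σ x) = b
    · rw [hσx, hx]
    · rw [σ.injective (h _ hσx)]
  · rw [h x hx]

namespace YoungTableau

variable {n : ℕ} {μ : YoungDiagram} (T : YoungTableau n μ)

theorem disjoint_rowGroup_colGroup : Disjoint T.rowGroup T.colGroup :=
  Subgroup.disjoint_def.2 fun {_} hrow hcol =>
    Equiv.ext fun x => T.injective (Subtype.ext (Prod.ext (hrow x) (hcol x)))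

theorem swap_mem_rowGroup {x y : Fin n} (h : (T x).1.1 = (T y).1.1) :
    Equiv.swap x y ∈ T.rowGroup :=
  Equiv.apply_swap_eq_self (v := fun x => (T x).1.1) h

theorem swap_mem_colGroup {x y : Fin n} (h : (T x).1.2 = (T y).1.2) :
    Equiv.swap x y ∈ T.colGroup :=
  Equiv.apply_swap_eq_self (v := fun x => (T x).1.2) h

/-- The cell in the row of an entry in `T` and the column of that entry in the tableau `g • T`,
where `g` is applied to the entries. It may lie outside the diagram. -/
def rowColCell (g : Equiv.Perm (Fin n)) (x : Fin n) : ℕ × ℕ :=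
  ((T x).1.1, (T (g⁻¹ x)).1.2)

variable {T} {g : Equiv.Perm (Fin n)}

theorem rowColCell_mem_cells (h : Function.Injective (T.rowColCell g)) (x : Fin n) :
    T.rowColCell g x ∈ μ.cells := by
  refine subset_cells_of_sum_hookLength_le (A := Finset.univ.image (T.rowColCell g)) (le_of_eq ?_)
    (Finset.mem_image_of_mem _ (Finset.mem_univ x))
  rw [Finset.sum_image h.injOn, ← Finset.sum_coe_sort μ.cells, ← T.sum_comp]
  simp only [hookLength, rowColCell, Finset.sum_add_distrib]
  congr 1
  exact (Equiv.sum_comp g⁻¹ fun y => ((μ.colLen (T y).1.2 : ℤ) - (T y).1.2 - 1)).symm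

theorem exists_eq_mul_of_injective_rowColCell (h : Function.Injective (T.rowColCell g)) :
    ∃ p ∈ T.rowGroup, ∃ q ∈ T.colGroup, g = p * q := by
  let S : Fin n → {c : ℕ × ℕ // c ∈ μ.cells} := fun x => ⟨_, rowColCell_mem_cells h x⟩
  have hS : Function.Injective (T.symm ∘ S) :=
    T.symm.injective.comp fun x y hxy => h (congrArg Subtype.val hxy)
  let p : Equiv.Perm (Fin n) := Equiv.ofBijective _ (Finite.injective_iff_bijective.1 hS)
  have hp (x : Fin n) : (T (p x)).1 = T.rowColCell g x :=
    congrArg Subtype.val (T.apply_symm_apply (S x))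
  refine ⟨p⁻¹, inv_mem fun x => by rw [hp, rowColCell], p * g, fun x => ?_,
    (inv_mul_cancel_left p g).symm⟩
  simp [hp, rowColCell]

theorem exists_swap_of_not_injective_rowColCell (h : ¬ Function.Injective (T.rowColCell g)) :
    ∃ p ∈ T.rowGroup, ∃ q ∈ T.colGroup, p * g = g * q ∧ Equiv.Perm.sign q = -1 := by
  obtain ⟨x, y, hxy, hne⟩ := Function.not_injective_iff.1 h
  rw [rowColCell, rowColCell, Prod.mk.injEq] at hxy
  refine ⟨Equiv.swap x y, T.swap_mem_rowGroup hxy.1, Equiv.swap (g⁻¹ x) (g⁻¹ y),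
    T.swap_mem_colGroup hxy.2, ?_, Equiv.Perm.sign_swap (g⁻¹.injective.ne hne)⟩
  simp [Equiv.mul_swap_eq_swap_mul]

/-- The sign of a permutation as a complex character. -/
def signChar : Equiv.Perm (Fin n) →* ℂ :=
  ((Int.castRingHom ℂ : ℤ →* ℂ).comp (Units.coeHom ℤ)).comp Equiv.Perm.sign

variable (T)

open Classical in
theorem symmetrizer_eq :
    T.symmetrizer = twistedSum 1 T.rowGroup * twistedSum signChar T.colGroup := by
  simp [symmetrizer, twistedSum, signChar]

theorem symmetrizer_ne_zero : T.symmetrizer ≠ 0 := by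
  classical
  rw [symmetrizer_eq]
  exact twistedSum_mul_twistedSum_ne_zero T.disjoint_rowGroup_colGroup

theorem exists_symmetrizer_mul_mul_eq_smul (x : ℂ[Equiv.Perm (Fin n)]) :
    ∃ c : ℂ, T.symmetrizer * x * T.symmetrizer = c • T.symmetrizer := by
  classical
  have hdichotomy (g : Equiv.Perm (Fin n)) : (∃ p ∈ T.rowGroup, ∃ q ∈ T.colGroup, g = p * q) ∨
      ∃ p ∈ T.rowGroup, ∃ q ∈ T.colGroup,
        p * g = g * q ∧ (1 : Equiv.Perm (Fin n) →* ℂ) p ≠ signChar q := by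
    refine (em _).imp exists_eq_mul_of_injective_rowColCell fun h => ?_
    obtain ⟨p, hp, q, hq, hpq, hsign⟩ := exists_swap_of_not_injective_rowColCell h
    exact ⟨p, hp, q, hq, hpq, by norm_num [signChar, hsign]⟩
  obtain ⟨c, hc⟩ := Submodule.mem_span_singleton.1 <| twistedSum_mul_mul_twistedSum_mem_span
    hdichotomy (twistedSum signChar T.colGroup * x * twistedSum 1 T.rowGroup)
  exact ⟨c, by simp only [symmetrizer_eq, hc, mul_assoc]⟩

instance isSimpleModule_spechtModule : IsSimpleModule ℂ[Equiv.Perm (Fin n)] T.spechtModule :=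
  isSimpleModule_span_singleton T.symmetrizer_ne_zero T.exists_symmetrizer_mul_mul_eq_smul

theorem exists_forall_rowGroup_smul_eq_self :
    ∃ v : T.spechtModule, v ≠ 0 ∧
      ∀ p ∈ T.rowGroup, MonoidAlgebra.of ℂ (Equiv.Perm (Fin n)) p • v = v := by
  classical
  refine ⟨⟨T.symmetrizer, Ideal.mem_span_singleton_self _⟩, ?_, fun p hp => Subtype.ext ?_⟩
  · exact fun h => T.symmetrizer_ne_zero (congrArg Subtype.val h)
  · change MonoidAlgebra.of ℂ _ p * T.symmetrizer = T.symmetrizer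
    rw [symmetrizer_eq, ← mul_assoc, of_mul_twistedSum hp, smul_mul_assoc,
      MonoidHom.one_apply, one_smul]

theorem exists_forall_colGroup_smul_eq_signChar_smul :
    ∃ v : T.spechtModule, v ≠ 0 ∧
      ∀ q ∈ T.colGroup, MonoidAlgebra.of ℂ (Equiv.Perm (Fin n)) q • v = signChar q • v := by
  classical
  obtain ⟨e, he, hspan⟩ := IsSemisimpleRing.ideal_eq_span_idempotent T.spechtModule
  have hmem : e ∈ T.spechtModule := hspan ▸ Ideal.mem_span_singleton_self e
  obtain ⟨y, hy⟩ := Ideal.mem_span_singleton'.1 hmem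
  refine ⟨⟨twistedSum signChar T.colGroup * e, Ideal.mul_mem_left _ _ hmem⟩, fun h => ?_,
    fun q hq => Subtype.ext ?_⟩
  · have hzero : twistedSum signChar T.colGroup * e = 0 := congrArg Subtype.val h
    have he0 : e = 0 := by
      rw [← he.eq]
      nth_rw 1 [← hy]
      rw [symmetrizer_eq, mul_assoc, mul_assoc, hzero, mul_zero, mul_zero]
    rw [he0, Ideal.span_singleton_zero, Ideal.span_singleton_eq_bot] at hspan
    exact T.symmetrizer_ne_zero hspan
  · change MonoidAlgebra.of ℂ _ q * (twistedSum signChar T.colGroup * e) =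
      signChar q • (twistedSum signChar T.colGroup * e)
    have hinv : signChar q⁻¹ = signChar q := by simp [signChar]
    rw [← mul_assoc, of_mul_twistedSum hq, smul_mul_assoc, hinv]

/-- The entries in the row of index `i`, counted from `0`. -/
def rowEntries (i : ℕ) : Finset (Fin n) := Finset.univ.filter fun x => (T x).1.1 = i

/-- The entries in the column of index `j`, counted from `0`. -/
def colEntries (j : ℕ) : Finset (Fin n) := Finset.univ.filter fun x => (T x).1.2 = j

theorem card_filter_apply (P : ℕ × ℕ → Prop) [DecidablePred P] :
    (Finset.univ.filter fun x => P (T x).1).card = (μ.cells.filter P).card :=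
  Finset.card_bij (fun x _ => (T x).1) (fun x hx => by simpa using hx)
    (fun _ _ _ _ h => T.injective (Subtype.ext h))
    fun c hc => ⟨T.symm ⟨c, (Finset.mem_filter.1 hc).1⟩, by simp [(Finset.mem_filter.1 hc).2]⟩

theorem card_rowEntries (i : ℕ) : (T.rowEntries i).card = μ.rowLen i := by
  rw [YoungDiagram.rowLen_eq_card]
  exact T.card_filter_apply (·.1 = i)

theorem card_colEntries (j : ℕ) : (T.colEntries j).card = μ.colLen j := by
  rw [YoungDiagram.colLen_eq_card]
  exact T.card_filter_apply (·.2 = j)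

variable {T} {σ : Equiv.Perm (Fin n)}

theorem mem_rowGroup_of_forall_notMem {i : ℕ} (h : ∀ x ∉ T.rowEntries i, σ x = x) :
    σ ∈ T.rowGroup :=
  apply_perm_eq_of_forall_ne (F := fun x => (T x).1.1) fun x hx => h x (by simpa [rowEntries])

theorem mem_colGroup_of_forall_notMem {j : ℕ} (h : ∀ x ∉ T.colEntries j, σ x = x) :
    σ ∈ T.colGroup :=
  apply_perm_eq_of_forall_ne (F := fun x => (T x).1.2) fun x hx => h x (by simpa [colEntries])

end YoungTableau

theorem apply_symm_eq_smul {k G V M : Type*} [CommSemiring k] [Monoid G] [AddCommMonoid V]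
    [Module k V] [AddCommMonoid M] [Module k M] [Module k[G] M] [IsScalarTower k k[G] M]
    {ρ : Representation k G V} (e : ρ.asModule ≃ₗ[k[G]] M) {g : G} {c : k} {m : M}
    (h : MonoidAlgebra.of k G g • m = c • m) :
    ρ g (ρ.asModuleEquiv (e.symm m)) = c • ρ.asModuleEquiv (e.symm m) := by
  rw [← ρ.asAlgebraHom_of g, ← ρ.asModuleEquiv_map_smul, ← map_smul e.symm, h]
  exact (e.restrictScalars k).symm.map_smul c m

theorem lemma7 {n : ℕ} {V : Type*} [AddCommGroup V] [Module ℂ V]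
    (ρ : Representation ℂ (Equiv.Perm (Fin n)) V) (μ : YoungDiagram)
    (hμ : IsIrrepOfShape ρ μ) (hbig : IsBig ρ) :
    (μ.rowLen 0 : ℝ) < 4 * √(n : ℝ) * Real.log n ∧
      (μ.colLen 0 : ℝ) < 4 * √(n : ℝ) * Real.log n := by
  obtain ⟨T, ⟨e⟩⟩ := hμ
  have : ρ.IsIrreducible :=
    ρ.irreducible_iff_isSimpleModule_asModule.2 (IsSimpleModule.congr e)
  have : FiniteDimensional ℂ T.spechtModule :=
    inferInstanceAs (FiniteDimensional ℂ (T.spechtModule.restrictScalars ℂ))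
  have : FiniteDimensional ℂ V := Module.Finite.equiv (e.restrictScalars ℂ).symm
  constructor
  · obtain ⟨v, hv0, hv⟩ := T.exists_forall_rowGroup_smul_eq_self
    rw [← T.card_rowEntries]
    exact card_lt_of_isBig hbig (T.rowEntries 0) (fun _ => 1) (by simpa using hv0) fun σ hσ =>
      apply_symm_eq_smul e <| (hv σ (YoungTableau.mem_rowGroup_of_forall_notMem hσ)).trans
        (one_smul ℂ v).symm
  · obtain ⟨v, hv0, hv⟩ := T.exists_forall_colGroup_smul_eq_signChar_smul
    rw [← T.card_colEntries]
    exact card_lt_of_isBig hbig (T.colEntries 0) YoungTableau.signChar (by simpa using hv0)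
      fun σ hσ => apply_symm_eq_smul e (hv σ (YoungTableau.mem_colGroup_of_forall_notMem hσ))
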